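/- Let $g\ge 0$ and let $\Sigma$ be a closed oriented surface of genus $g$ with $\pi_1(\Sigma)=\langle a_1,\dots,a_g,b_1,\dots,b_g\mid\prod_{i=1}^g[a_i,b_i]=1\rangle$, $a_i,b_i$ being the standard generators (intersection numbers $a_i\cdot b_j=\delta_{ij}$, $a_i\cdot a_j=b_i\cdot b_j=0$). Let $\widetilde\Sigma_a$ be the handlebody with boundary $\Sigma$ obtained by killing the $a_i$, so that $\pi_1(\widetilde\Sigma_a)$ is the free group on $b_1,\dots,b_g$. Put $$J_\Sigma=\operatorname{Hom}(\pi_1(\Sigma),U(1))\cong H_1(\Sigma,\mathbb R)/H_1(\Sigma,\mathbb Z),\qquad J_{\widetilde\Sigma_a}=H_1(\widetilde\Sigma_a,\mathbb R)/H_1(\widetilde\Sigma_a,\mathbb Z)$$ (the isomorphism is Poincaré duality), let $K_\Sigma=J_\Sigma/\{\pm\mathrm{id}\}$ and $K_{\widetilde\Sigma_a}=J_{\widetilde\Sigma_a}/\{\pm\mathrm{id}\}$ be the Kummer varieties, with the quotient topology, and let $\pi\colon K_\Sigma\to K_{\widetilde\Sigma_a}$ be the real polarization induced by the natural map $J_\Sigma\to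 J_{\widetilde\Sigma_a}$. Let $\operatorname{Sing}K_\Sigma$ be the image in $K_\Sigma$ of the $2$-torsion subgroup $(J_\Sigma)_2$. The fibre $\pi^{-1}(w)$ is called singular if $w$ is the image of a $2$-torsion point of $J_{\widetilde\Sigma_a}$. Let $\omega=\sum_i d\alpha_i\wedge d\beta_i$ on $J_\Sigma$, where $\alpha_i,\beta_i\in\mathbb R/\mathbb Z$ are the coordinates $\rho(a_i)=e^{2\pi i\alpha_i}$, $\rho(b_i)=e^{2\pi i\beta_i}$, and let $L_\Theta$ be the line bundle of the classical symmetric theta divisor on $J_\Sigma$, with its Hermitian connection $a$ of curvature $2\pi i\,\omega$: on the universal cover $\mathbb R^{2g}$ the connection is $d+\pi i\,\omega(x,dx)$, and $l=(m,n)\in\mathbb Z^{2g}$ acts by $(x,z)\mapsto(x+l,(-1)^{m\cdot n}e^{-\pi i\,\omega(l,x)}z)$. For an integer $k\ge 0$, the fibre $\pi^{-1}(w)$ is a level $k$ Bohr–Sommerfeld ($\mathrm{BS}_k$) fibre if the monodromy of $(L_\Theta^k,a)$ along every loop in the preimage of $\pi^{-1}(w)$ in $J_\Sigma$ is trivial.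 **Proposition 3.2.** For every singular $\mathrm{BS}_k$ fibre $\pi^{-1}(w)$ of $\pi\colon K_\Sigma\to K_{\widetilde\Sigma_a}$, $$H_1(\pi^{-1}(w),\mathbb Z)=H_1(\pi^{-1}(w)\cap\operatorname{Sing}K_\Sigma,\mathbb Z);$$ more precisely, the inclusion $\pi^{-1}(w)\cap\operatorname{Sing}K_\Sigma\hookrightarrow\pi^{-1}(w)$ induces an isomorphism on the first integral singular homology. -/

import Mathlib

open scoped TensorProduct

noncomputable section

namespace KummerPolarization

/-! ## The surface, the handlebody, and their first homology -/

/-- The letters `a_1, …, a_g, b_1, …, b_g`. -/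
inductive Gen (g : ℕ) : Type
  | a (i : Fin g) : Gen g
  | b (i : Fin g) : Gen g

/-- The word `∏_{i=1}^g [a_i, b_i]`. -/
def surfaceWord (g : ℕ) : FreeGroup (Gen g) :=
  (List.ofFn fun i : Fin g =>
    FreeGroup.of (Gen.a i) * FreeGroup.of (Gen.b i) *
      (FreeGroup.of (Gen.a i))⁻¹ * (FreeGroup.of (Gen.b i))⁻¹).prod

/-- The fundamental group of the closed oriented surface of genus `g`,
`⟨a_1, …, a_g, b_1, …, b_g ∣ ∏ [a_i, b_i] = 1⟩`. -/
abbrev SurfaceGroup (g : ℕ) : Type := PresentedGroup {surfaceWord g}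

/-- The generator `a_i` of the surface group. -/
def genA {g : ℕ} (i : Fin g) : SurfaceGroup g := PresentedGroup.of (Gen.a i)

/-- The generator `b_i` of the surface group. -/
def genB {g : ℕ} (i : Fin g) : SurfaceGroup g := PresentedGroup.of (Gen.b i)

/-- The fundamental group of the handlebody bounded by the surface in which the `a_i` are
contractible: the free group on `b_1, …, b_g`. -/
abbrev HandlebodyGroup (g : ℕ) : Type := FreeGroup (Fin g)

/-- The value on the letters of the map killing the `a_i`. -/
def killALetter (g : ℕ) : Gen g → HandlebodyGroup g
  | Gen.a _ => 1
  | Gen.b i => FreeGroup.of i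

theorem killA_rel (g : ℕ) :
    ∀ r ∈ ({surfaceWord g} : Set (FreeGroup (Gen g))), FreeGroup.lift (killALetter g) r = 1 := by
  intro r hr
  rw [Set.mem_singleton_iff] at hr
  subst hr
  rw [surfaceWord, map_list_prod]
  apply List.prod_eq_one
  intro x hx
  simp only [List.mem_map, List.mem_ofFn] at hx
  obtain ⟨_, ⟨i, rfl⟩, rfl⟩ := hx
  simp [killALetter]

/-- The map `π_1(Σ) → π_1(handlebody)` induced by the inclusion of the boundary: it kills the
generators `a_i` and sends `b_i` to `b_i`. -/
def killA (g : ℕ) : SurfaceGroup g →* HandlebodyGroup g :=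
  PresentedGroup.toGroup (killA_rel g)

/-- The first integral homology of a connected space with fundamental group `G`. -/
abbrev HOne (G : Type) [Group G] : Type := Additive (Abelianization G)

/-- The homomorphism induced on the first integral homology. -/
def HOne.map {G G' : Type} [Group G] [Group G'] (f : G →* G') : HOne G →+ HOne G' :=
  MonoidHom.toAdditive (Abelianization.map f)

/-- The homology class of an element of the fundamental group. -/
def HOne.mk {G : Type} [Group G] (γ : G) : HOne G := Additive.ofMul (Abelianization.of γ)

/-- The image of the integral homology in the real homology `ℝ ⊗ H_1(·, ℤ)`. -/
def integralClasses (G : Type) [Group G] : AddSubgroup (ℝ ⊗[ℤ] HOne G) :=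
  (TensorProduct.mk ℤ ℝ (HOne G) 1).toAddMonoidHom.range

/-- `H_1(·, ℝ) / H_1(·, ℤ)`. -/
abbrev HomologyTorus (G : Type) [Group G] : Type := (ℝ ⊗[ℤ] HOne G) ⧸ integralClasses G

theorem integralClasses_le_comap {G G' : Type} [Group G] [Group G'] (f : G →* G') :
    integralClasses G ≤ (integralClasses G').comap
      (LinearMap.lTensor ℝ (HOne.map f).toIntLinearMap).toAddMonoidHom := by
  rintro _ ⟨c, rfl⟩
  exact ⟨HOne.map f c, by simp⟩

/-- The map `H_1(·, ℝ) / H_1(·, ℤ) → H_1(·, ℝ) / H_1(·, ℤ)` induced by a homomorphism of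
fundamental groups. -/
def HomologyTorus.map {G G' : Type} [Group G] [Group G'] (f : G →* G') :
    HomologyTorus G →+ HomologyTorus G' :=
  QuotientAddGroup.map _ _ (LinearMap.lTensor ℝ (HOne.map f).toIntLinearMap).toAddMonoidHom
    (integralClasses_le_comap f)

theorem zmultiples_le_comap {G : Type} [Group G] (c : HOne G) :
    AddSubgroup.zmultiples (1 : ℝ) ≤ (integralClasses G).comap
      ((TensorProduct.mk ℤ ℝ (HOne G)).flip c).toAddMonoidHom := by
  rw [AddSubgroup.zmultiples_le]
  exact ⟨c, rfl⟩

/-- For an integral class `c`, the homomorphism `ℝ/ℤ → H_1(·, ℝ) / H_1(·, ℤ)`, `t ↦ t • c`. -/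
def HomologyTorus.smulClass {G : Type} [Group G] (c : HOne G) :
    UnitAddCircle →+ HomologyTorus G :=
  QuotientAddGroup.map _ _ ((TensorProduct.mk ℤ ℝ (HOne G)).flip c).toAddMonoidHom
    (zmultiples_le_comap c)

/-- The Jacobian of the handlebody, `H_1(·, ℝ) / H_1(·, ℤ)`. -/
abbrev HandlebodyJacobian (g : ℕ) : Type := HomologyTorus (HandlebodyGroup g)

/-! ## The Jacobian of the surface and its map to the Jacobian of the handlebody -/

/-- The Jacobian `Hom(π_1(Σ), U(1))` of the surface, written additively. -/
def Jacobian (g : ℕ) : Type := Additive (SurfaceGroup g →* Circle)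

instance (g : ℕ) : AddCommGroup (Jacobian g) :=
  inferInstanceAs (AddCommGroup (Additive (SurfaceGroup g →* Circle)))

/-- The value of a point of the Jacobian, that is, of a character, at a loop. -/
def Jacobian.eval {g : ℕ} (ρ : Jacobian g) (γ : SurfaceGroup g) : Circle :=
  (Additive.toMul ρ : SurfaceGroup g →* Circle) γ

/-- The topology of pointwise convergence of characters. -/
instance (g : ℕ) : TopologicalSpace (Jacobian g) :=
  TopologicalSpace.induced Jacobian.eval inferInstance

/-- The angle of a point of the circle in `ℝ/ℤ`: the inverse of `t ↦ exp(2πit)`. -/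
def angle (z : Circle) : UnitAddCircle := ((Complex.arg z / (2 * Real.pi) : ℝ) : UnitAddCircle)

theorem toCircle_angle (z : Circle) : (angle z).toCircle = z := by
  rw [angle, AddCircle.toCircle_apply_mk]
  have h : 2 * Real.pi / 1 * (Complex.arg z / (2 * Real.pi)) = Complex.arg z := by
    have := Real.pi_pos.ne'
    field_simp
  rw [h, Circle.exp_arg]

theorem angle_mul (z w : Circle) : angle (z * w) = angle z + angle w := by
  apply AddCircle.injective_toCircle one_ne_zero
  rw [AddCircle.toCircle_add, toCircle_angle, toCircle_angle, toCircle_angle]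

theorem angle_one : angle 1 = 0 := by
  simp [angle]

/-- The homomorphism from the Jacobian to `ℝ/ℤ` given by the angle of the value at a loop. -/
def Jacobian.angleAt {g : ℕ} (γ : SurfaceGroup g) : Jacobian g →+ UnitAddCircle where
  toFun ρ := angle (ρ.eval γ)
  map_zero' := angle_one
  map_add' ρ σ := angle_mul (ρ.eval γ) (σ.eval γ)

/-- Poincaré duality `H^1(Σ, ℝ/ℤ) = Hom(π_1(Σ), U(1)) → H_1(Σ, ℝ) / H_1(Σ, ℤ)`. With the
intersection form `a_i · b_j = δ_ij`, `a_i · a_j = b_i · b_j = 0`, the character `ρ` is sent to the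
class `x` such that `ρ(γ) = exp(2πi γ · x)` for all `γ`, namely
`x = ∑ angle (ρ a_i) b_i - angle (ρ b_i) a_i`. -/
def poincareDuality (g : ℕ) : Jacobian g →+ HomologyTorus (SurfaceGroup g) :=
  ∑ i : Fin g,
    ((HomologyTorus.smulClass (HOne.mk (genB i))).comp (Jacobian.angleAt (genA i)) -
      (HomologyTorus.smulClass (HOne.mk (genA i))).comp (Jacobian.angleAt (genB i)))

/-- The real polarization `π : J_Σ → J_handlebody`: the natural map, induced by the inclusion of
the surface in the handlebody, on `H_1(·, ℝ) / H_1(·, ℤ)`. -/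
def jacobianMap (g : ℕ) : Jacobian g →+ HandlebodyJacobian g :=
  (HomologyTorus.map (killA g)).comp (poincareDuality g)

/-! ## Kummer varieties -/

/-- The orbit relation of `{± id}` on an abelian group. -/
def kummerSetoid (A : Type) [AddCommGroup A] : Setoid A where
  r x y := x = y ∨ x = -y
  iseqv :=
    { refl := fun _ => Or.inl rfl
      symm := by
        rintro x y (rfl | rfl)
        · exact Or.inl rfl
        · exact Or.inr (neg_neg y).symm
      trans := by
        rintro x y z (rfl | rfl) (rfl | rfl)
        · exact Or.inl rfl
        · exact Or.inr rfl
        · exact Or.inr rfl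
        · exact Or.inl (neg_neg z) }

/-- The quotient `A / {± id}`; if `A` has a topology, this carries the quotient topology. -/
abbrev KummerQuotient (A : Type) [AddCommGroup A] : Type := Quotient (kummerSetoid A)

/-- The quotient map `A → A / {± id}`. -/
abbrev KummerQuotient.mk {A : Type} [AddCommGroup A] (x : A) : KummerQuotient A :=
  Quotient.mk (kummerSetoid A) x

/-- The map of quotients by `{± id}` induced by a homomorphism. -/
def KummerQuotient.map {A B : Type} [AddCommGroup A] [AddCommGroup B] (f : A →+ B) :
    KummerQuotient A → KummerQuotient B :=
  Quotient.map f (by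
    rintro x y (rfl | rfl)
    · exact Or.inl rfl
    · exact Or.inr (map_neg f y))

/-- The image in `A / {± id}` of the points of order dividing 2 of `A`. -/
def KummerQuotient.twoTorsion (A : Type) [AddCommGroup A] : Set (KummerQuotient A) :=
  KummerQuotient.mk '' {x : A | 2 • x = 0}

/-- The Kummer variety `K_Σ = J_Σ / {± id}`, with the quotient topology. -/
abbrev Kummer (g : ℕ) : Type := KummerQuotient (Jacobian g)

/-- The Kummer variety of the Jacobian of the handlebody. -/
abbrev HandlebodyKummer (g : ℕ) : Type := KummerQuotient (HandlebodyJacobian g)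

/-- The real polarization `π : K_Σ → K_handlebody`. -/
def kummerMap (g : ℕ) : Kummer g → HandlebodyKummer g := KummerQuotient.map (jacobianMap g)

/-- The (orbifold) singular locus `Sing K_Σ`: the 2-torsion points of the Jacobian, that is, the
points at which the involution `- id` does not act freely. -/
def singularLocus (g : ℕ) : Set (Kummer g) := KummerQuotient.twoTorsion (Jacobian g)

/-- The fibre `π⁻¹(w)` of the real polarization of `K_Σ`. -/
def fibre {g : ℕ} (w : HandlebodyKummer g) : Set (Kummer g) := kummerMap g ⁻¹' {w}

/-- The singular fibres `π⁻¹(w)` are those over the 2-torsion points `w` (the others do not meet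
`Sing K_Σ`, and are tori). -/
def IsSingularFibre {g : ℕ} (w : HandlebodyKummer g) : Prop :=
  w ∈ KummerQuotient.twoTorsion (HandlebodyJacobian g)

/-! ## The prequantum line bundle and Bohr–Sommerfeld fibres

The universal cover of `J_Σ = H^1(Σ, ℝ) / H^1(Σ, ℤ)` is `H^1(Σ, ℝ)`, with the coordinates
`α_i = x(a_i)`, `β_i = x(b_i)`. The line bundle `L_Θ` is the quotient of the trivial bundle over it
by the action `(x, z) ↦ (x + l, e_l(x) z)` of the lattice `H^1(Σ, ℤ)`. -/

/-- `H^1(Σ, ℝ)` in the coordinates `(α, β)`. -/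
abbrev Cover (g : ℕ) : Type := (Fin g → ℝ) × (Fin g → ℝ)

/-- The value on the letters of the character `γ ↦ exp(2πi x(γ))`. -/
def coverLetter {g : ℕ} (x : Cover g) : Gen g → Circle
  | Gen.a i => Circle.exp (2 * Real.pi * x.1 i)
  | Gen.b i => Circle.exp (2 * Real.pi * x.2 i)

theorem cover_rel {g : ℕ} (x : Cover g) :
    ∀ r ∈ ({surfaceWord g} : Set (FreeGroup (Gen g))), FreeGroup.lift (coverLetter x) r = 1 := by
  intro r hr
  rw [Set.mem_singleton_iff] at hr
  subst hr
  rw [surfaceWord, map_list_prod]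
  apply List.prod_eq_one
  intro y hy
  simp only [List.mem_map, List.mem_ofFn] at hy
  obtain ⟨_, ⟨i, rfl⟩, rfl⟩ := hy
  simp only [map_mul, map_inv]
  rw [mul_comm (FreeGroup.lift (coverLetter x) (FreeGroup.of (Gen.a i)))]
  group

/-- The covering map `H^1(Σ, ℝ) → J_Σ`, `x ↦ exp(2πi x)`. -/
def coverMap {g : ℕ} (x : Cover g) : Jacobian g :=
  Additive.ofMul (PresentedGroup.toGroup (cover_rel x))

/-- The symplectic form `ω = ∑ dα_i ∧ dβ_i` on `H^1(Σ, ℝ)` (the cup product). -/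
def symplecticForm {g : ℕ} (x y : Cover g) : ℝ := ∑ i : Fin g, (x.1 i * y.2 i - x.2 i * y.1 i)

/-- The lattice point of `H^1(Σ, ℤ)` with coordinates `(m, n)`. -/
def latticePoint {g : ℕ} (m n : Fin g → ℤ) : Cover g := (fun i => (m i : ℝ), fun i => (n i : ℝ))

/-- The multiplier `e_l(x) = (-1)^{m·n} exp(-πi ω(l, x))`, `l = (m, n)`, of the line bundle
`L_Θ` of the classical symmetric theta divisor. -/
def multiplier {g : ℕ} (m n : Fin g → ℤ) (x : Cover g) : ℂ :=
  (-1 : ℂ) ^ (∑ i : Fin g, m i * n i) *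
    Complex.exp (-(Real.pi * Complex.I * (symplecticForm (latticePoint m n) x : ℂ)))

/-- `z` is a parallel section of `L_Θ^k` along the path `x` in the universal cover, for the
connection `∇ = d + πi ω(x, dx)` on `L_Θ`, whose curvature is `2πi ω`. -/
def IsParallelAlong {g : ℕ} (k : ℕ) (x : ℝ → Cover g) (z : ℝ → ℂ) : Prop :=
  ∀ t : ℝ, HasDerivAt z
    (-(k * (Real.pi * Complex.I * (symplecticForm (x t) (deriv x t) : ℂ))) * z t) t

/-- The monodromy of `(L_Θ^k, a)` is trivial along every loop contained in the subset `F` of `J_Σ`.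
A loop in `J_Σ` is a path `x` in the universal cover with `x 1 = x 0 + l` for some lattice point
`l`; parallel transport takes `z 0` to `z 1`, and `(x 0, z 0)` and `(x 0 + l, e_l(x 0)^k z 0)`
are the same point of `L_Θ^k`. -/
def HasTrivialMonodromy {g : ℕ} (k : ℕ) (F : Set (Jacobian g)) : Prop :=
  ∀ (x : ℝ → Cover g) (m n : Fin g → ℤ), ContDiff ℝ 1 x →
    (∀ t ∈ Set.Icc (0 : ℝ) 1, coverMap (x t) ∈ F) → x 1 = x 0 + latticePoint m n →
    ∀ z : ℝ → ℂ, IsParallelAlong k x z → z 1 = multiplier m n (x 0) ^ k * z 0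

/-- The fibre `π⁻¹(w)` is a level `k` Bohr–Sommerfeld fibre: the monodromy of `(L_Θ^k, a)` along
the (Lagrangian) fibres of `J_Σ → J_handlebody` lying over `π⁻¹(w)` is trivial. -/
def IsBohrSommerfeld {g : ℕ} (k : ℕ) (w : HandlebodyKummer g) : Prop :=
  HasTrivialMonodromy k ((KummerQuotient.mk : Jacobian g → Kummer g) ⁻¹' fibre w)

/-! ## Homology of subspaces of the Kummer variety -/

/-- The functor `H_1(·, ℤ)` of singular homology. -/
abbrev homologyOne : CategoryTheory.Functor TopCat.{0} (ModuleCat.{0} ℤ) :=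
  (AlgebraicTopology.singularHomologyFunctor (ModuleCat.{0} ℤ) 1).obj (ModuleCat.of ℤ ℤ)

/-- The inclusion of a subspace in a larger one. -/
def subspaceInclusion {X : Type} [TopologicalSpace X] {S T : Set X} (h : S ⊆ T) :
    Quiver.Hom (TopCat.of S) (TopCat.of T) :=
  TopCat.ofHom ⟨Set.inclusion h, continuous_inclusion h⟩

end KummerPolarization

end

noncomputable section

open CategoryTheory Limits Simplicial unitInterval

namespace KummerPolarization

/-! ## Vanishing of the first singular homology from the triviality of cocycles on paths -/

/-! Both homology groups vanish, so the map between them is an isomorphism. The set `π⁻¹(w) ∩ Sing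
K_Σ` is finite and Hausdorff, hence discrete. On a nonempty singular fibre the coordinates α are
fixed and half-integral, so `- id` acts there by β ↦ -β, and the fibre is the quotient of ℝ^g by the
group of maps β ↦ n ± β with n integral. This group is generated by the central symmetries β ↦ n -
β. Each has the fixed point n/2, so the segment from β to n - β maps to a path followed by its own
reverse and carries no homology.

The argument is run on cocycles. Sending a path to its class among 1-chains modulo boundaries is a
path cocycle, and H_1 vanishes as soon as every path cocycle is a difference of values at the
endpoints (`isZero_homology_one`). The potential at x is the value of the cocycle on the image of
the segment from 0 to a lift of x. It does not depend on the lift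
(`IsPathCocycle.segmentPath_eq_zero_of_eq`), and radial contractions of small open sets
(`exists_local_contraction`) show that it computes the cocycle on short paths, hence on all paths
(`IsPathCocycle.exists_eq_sub`). No path is ever lifted to ℝ^g. -/

/-- An `A`-valued cocycle on the paths of `X`: it vanishes on constant paths and its sum along the
boundary of every square is zero. -/
structure IsPathCocycle {X A : Type} [TopologicalSpace X] [AddCommGroup A] (c : C(I, X) → A) :
    Prop where
  const : ∀ x : X, c (ContinuousMap.const I x) = 0
  square : ∀ H : C(I × I, X),
    c ⟨fun s => H (s, 0), by fun_prop⟩ + c ⟨fun t => H (1, t), by fun_prop⟩ =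
      c ⟨fun t => H (0, t), by fun_prop⟩ + c ⟨fun s => H (s, 1), by fun_prop⟩

/-! ### Singular simplices of dimension 1 and 2, and the universal path cocycle -/

section Simplices

variable {X : TopCat.{0}}

/-- The singular 1-simplex given by a path. -/
def pathSimplex (γ : C(I, X)) : TopCat.toSSet.obj X _⦋1⦌ :=
  (X.toSSetObjEquiv _).symm (γ.comp (toContinuousMap stdSimplexHomeomorphUnitInterval))

theorem pathSimplex_surjective (x : TopCat.toSSet.obj X _⦋1⦌) : ∃ γ, pathSimplex γ = x :=
  ⟨(X.toSSetObjEquiv _ x).comp (toContinuousMap stdSimplexHomeomorphUnitInterval.symm), by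
    apply (X.toSSetObjEquiv _).injective
    ext t
    simp [pathSimplex]⟩

/-- The face of index 0 omits the vertex 0, so it is the endpoint of the path; the face of index 1
is its origin. -/
theorem δ_pathSimplex (γ : C(I, X)) (i : Fin 2) (t : I) (ht : (t : ℝ) = if i = 0 then 1 else 0) :
    (TopCat.toSSet.obj X).δ i (pathSimplex γ) = TopCat.toSSetObj₀Equiv.symm (γ t) := by
  apply TopCat.toSSetObj₀Equiv.injective
  rw [Equiv.apply_symm_apply]
  change γ (stdSimplexHomeomorphUnitInterval (stdSimplex.map i.succAbove default)) = γ t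
  congr 1
  rw [Subsingleton.elim (default : stdSimplex ℝ (Fin 1)) (stdSimplex.vertex 0),
    stdSimplex.map_vertex]
  ext
  rw [ht]
  fin_cases i <;> rfl

/-- The singular 2-simplex `(x₀, x₁, x₂) ↦ H (x₁ + x₂, x₂)`. -/
def triangle (H : C(I × I, X)) : TopCat.toSSet.obj X _⦋2⦌ :=
  (X.toSSetObjEquiv _).symm (H.comp
    ⟨fun x : stdSimplex ℝ (Fin 3) =>
      (⟨x 1 + x 2, by
        have := stdSimplex.sum_eq_one x
        rw [Fin.sum_univ_three] at this
        exact ⟨add_nonneg (x.2.1 1) (x.2.1 2), by linarith [x.2.1 0, show x.1 0 = x 0 from rfl]⟩⟩,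
       ⟨x 2, stdSimplex.zero_le x 2, stdSimplex.le_one x 2⟩), by
      have h (i : Fin 3) : Continuous fun x : stdSimplex ℝ (Fin 3) => x i :=
        (continuous_apply i).comp continuous_subtype_val
      exact (Continuous.subtype_mk ((h 1).add (h 2)) _).prodMk (Continuous.subtype_mk (h 2) _)⟩)

/-- Leaving a and b free with prescribed real values lets each face computation substitute 0, 1 or
the barycentric coordinate for them. -/
theorem δ_triangle_aux (H : C(I × I, X)) (i : Fin 3) (γ : C(I, X))
    (h : ∀ (z : stdSimplex ℝ (Fin 2)) (a b : I),
      (a : ℝ) = stdSimplex.map i.succAbove z 1 + stdSimplex.map i.succAbove z 2 →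
      (b : ℝ) = stdSimplex.map i.succAbove z 2 →
      H (a, b) = γ (stdSimplexHomeomorphUnitInterval z)) :
    (TopCat.toSSet.obj X).δ i (triangle H) = pathSimplex γ := by
  apply (X.toSSetObjEquiv _).injective
  ext z
  exact h z _ _ rfl rfl

theorem stdSimplex_map_succAbove (i : Fin 3) (z : stdSimplex ℝ (Fin 2)) (j : Fin 3) :
    stdSimplex.map i.succAbove z j =
      (if i.succAbove 0 = j then z 0 else 0) + (if i.succAbove 1 = j then z 1 else 0) := by
  rw [stdSimplex.map_coe, FunOnFinite.linearMap_apply_apply, Finset.sum_filter, Fin.sum_univ_two]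

theorem δ_zero_triangle (H : C(I × I, X)) :
    (TopCat.toSSet.obj X).δ 0 (triangle H) =
      pathSimplex ⟨fun t => H (1, t), by fun_prop⟩ := by
  refine δ_triangle_aux H 0 _ fun z a b ha hb => ?_
  have hz := stdSimplex.add_eq_one z
  have hz' : (stdSimplexHomeomorphUnitInterval z : ℝ) = z 1 := rfl
  rw [stdSimplex_map_succAbove] at ha hb
  rw [stdSimplex_map_succAbove] at ha
  obtain rfl : a = 1 := by
    ext; rw [ha]; simp [Fin.succAbove, Fin.ext_iff, hz]
  obtain rfl : b = stdSimplexHomeomorphUnitInterval z := by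
    ext; rw [hb]; simp [Fin.succAbove, Fin.ext_iff, hz']
  rfl

theorem δ_one_triangle (H : C(I × I, X)) :
    (TopCat.toSSet.obj X).δ 1 (triangle H) =
      pathSimplex ⟨fun t => H (t, t), by fun_prop⟩ := by
  refine δ_triangle_aux H 1 _ fun z a b ha hb => ?_
  have hz' : (stdSimplexHomeomorphUnitInterval z : ℝ) = z 1 := rfl
  rw [stdSimplex_map_succAbove] at ha hb
  rw [stdSimplex_map_succAbove] at ha
  obtain rfl : a = stdSimplexHomeomorphUnitInterval z := by
    ext; rw [ha]; simp [Fin.succAbove, Fin.ext_iff, hz']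
  obtain rfl : b = stdSimplexHomeomorphUnitInterval z := by
    ext; rw [hb]; simp [Fin.succAbove, Fin.ext_iff, hz']
  rfl

theorem δ_two_triangle (H : C(I × I, X)) :
    (TopCat.toSSet.obj X).δ 2 (triangle H) =
      pathSimplex ⟨fun s => H (s, 0), by fun_prop⟩ := by
  refine δ_triangle_aux H 2 _ fun z a b ha hb => ?_
  have hz' : (stdSimplexHomeomorphUnitInterval z : ℝ) = z 1 := rfl
  rw [stdSimplex_map_succAbove] at ha hb
  rw [stdSimplex_map_succAbove] at ha
  obtain rfl : a = stdSimplexHomeomorphUnitInterval z := by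
    ext; rw [ha]; simp [Fin.succAbove, Fin.ext_iff, hz']
  obtain rfl : b = 0 := by
    ext; rw [hb]; simp [Fin.succAbove, Fin.ext_iff]
  rfl

variable {C : Type 1} [Category.{0} C] [Preadditive C] [HasCoproducts.{0} C]
  [CategoryWithHomology C] (R : C)

/-- The class of a path in the 1-chains modulo boundaries. -/
def pathClass (γ : C(I, X)) :
    Quiver.Hom R (((TopCat.toSSet.obj X).chainComplex R).opcycles 1) :=
  (TopCat.toSSet.obj X).ιChainComplex (pathSimplex γ) ≫
    ((TopCat.toSSet.obj X).chainComplex R).pOpcycles 1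

/-- The boundary of the triangle below the diagonal of the square is zero modulo boundaries. -/
theorem pathClass_triangle (H : C(I × I, X)) :
    pathClass R ⟨fun t => H (1, t), by fun_prop⟩ + pathClass R ⟨fun s => H (s, 0), by fun_prop⟩ =
      pathClass R ⟨fun t => H (t, t), by fun_prop⟩ := by
  have h := (TopCat.toSSet.obj X).ιChainComplex (R := R) (triangle H) ≫=
    ((TopCat.toSSet.obj X).chainComplex R).d_pOpcycles 2 1
  rw [SSet.ιChainComplex_d_assoc, comp_zero, Preadditive.sum_comp, Fin.sum_univ_three] at h
  simp only [δ_zero_triangle, δ_one_triangle, δ_two_triangle] at h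
  simp only [Fin.val_zero, Fin.val_one, Fin.val_two, pow_zero, pow_one, one_smul,
    neg_smul, Preadditive.neg_comp, even_two, Even.neg_pow, one_pow] at h
  change pathClass R _ + -pathClass R _ + pathClass R _ = 0 at h
  rw [← sub_eq_zero, ← h]
  abel

theorem isPathCocycle_pathClass : IsPathCocycle (pathClass (X := X) R) where
  const x := by
    -- All three edges are the same constant path, so its class c satisfies c + c = c.
    have := pathClass_triangle R (ContinuousMap.const (I × I) x)
    simpa [ContinuousMap.const] using this
  square H := by
    have h₁ := pathClass_triangle R H
    -- The upper half of the square is the lower half of its transpose, with the same diagonal.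
    have h₂ := pathClass_triangle R (H.comp ⟨Prod.swap, continuous_swap⟩)
    simp at h₁ h₂
    rw [add_comm, h₁, ← h₂, add_comm]

/-- If every cocycle on paths is a coboundary, the first singular homology vanishes. -/
theorem isZero_homology_one
    (hX : ∀ (A : Type) [AddCommGroup A] (c : C(I, X) → A), IsPathCocycle c →
      ∃ f : X → A, ∀ γ, c γ = f (γ 1) - f (γ 0)) :
    IsZero (((AlgebraicTopology.singularHomologyFunctor C 1).obj R).obj X) := by
  obtain ⟨f, hf⟩ := hX _ _ (isPathCocycle_pathClass (X := X) R)
  let K := (TopCat.toSSet.obj X).chainComplex R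
  let F : K.X 0 ⟶ K.opcycles 1 :=
    Cofan.IsColimit.desc ((TopCat.toSSet.obj X).isColimitChainComplexXCofan R 0)
      fun x => f (TopCat.toSSetObj₀Equiv x)
  have hF (x) : (TopCat.toSSet.obj X).ιChainComplex x ≫ F = f (TopCat.toSSetObj₀Equiv x) :=
    Cofan.IsColimit.fac _ _ _
  have hd : K.d 1 0 ≫ F = K.pOpcycles 1 := by
    apply SSet.chainComplex_hom_ext
    intro x
    obtain ⟨γ, rfl⟩ := pathSimplex_surjective x
    rw [SSet.ιChainComplex_d_assoc, Preadditive.sum_comp, Fin.sum_univ_two,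
      δ_pathSimplex γ 0 1 (by simp), δ_pathSimplex γ 1 0 (by simp)]
    simp only [Fin.val_zero, Fin.val_one, pow_zero, pow_one, one_smul, neg_smul,
      Preadditive.neg_comp, hF, Equiv.apply_symm_apply]
    rw [← sub_eq_add_neg, ← hf γ]
    rfl
  -- F retracts the map from chains modulo boundaries to 0-chains, whose kernel is H_1.
  have hs : K.fromOpcycles 1 0 ≫ F = 𝟙 _ := by
    rw [← cancel_epi (K.pOpcycles 1), HomologicalComplex.p_fromOpcycles_assoc, hd, Category.comp_id]
  have h0 : K.homologyι 1 = 0 := by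
    rw [← Category.comp_id (K.homologyι 1), ← hs, HomologicalComplex.homologyι_comp_fromOpcycles_assoc,
      zero_comp]
  change IsZero (K.homology 1)
  rw [IsZero.iff_id_eq_zero, ← cancel_mono (K.homologyι 1), h0, comp_zero, comp_zero]

end Simplices

end KummerPolarization
end

noncomputable section

open unitInterval

namespace KummerPolarization

/-! ## Cocycles on the paths of a space covered by a vector space -/

section Segments

variable {E X A : Type} [AddCommGroup E] [Module ℝ E] [TopologicalSpace E]
  [IsTopologicalAddGroup E] [ContinuousSMul ℝ E] [TopologicalSpace X] [AddCommGroup A]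

/-- The image of the segment from `u` to `v`. -/
def segmentPath (q : C(E, X)) (u v : E) : C(I, X) :=
  ⟨fun s => q (u + (s : ℝ) • (v - u)), by fun_prop⟩

theorem IsPathCocycle.segmentPath_add {c : C(I, X) → A} (hc : IsPathCocycle c) (q : C(E, X))
    (u v w : E) :
    c (segmentPath q u v) + c (segmentPath q v w) = c (segmentPath q u w) := by
  -- The square collapses the side s = 0 to u and carries the side s = 1 along the segment from v to
  -- w.
  have h := hc.square ⟨fun x => q (u + (x.1 : ℝ) • ((v - u) + (x.2 : ℝ) • (w - v))), by fun_prop⟩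
  have h0 : c ⟨fun _ => q u, continuous_const⟩ = 0 := hc.const (q u)
  simp only [ContinuousMap.coe_mk, Set.Icc.coe_zero, Set.Icc.coe_one, zero_smul, add_zero,
    one_smul, h0, zero_add, add_sub_cancel, ← add_assoc] at h
  simp only [sub_add_sub_cancel'] at h
  exact h

theorem IsPathCocycle.segmentPath_self {c : C(I, X) → A} (hc : IsPathCocycle c) (q : C(E, X))
    (u : E) : c (segmentPath q u u) = 0 := by
  simpa using hc.segmentPath_add q u u u

/-- A function on paths which is the difference of the values of `f` at the endpoints, locally on
`X`, is so globally. -/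
theorem IsPathCocycle.eq_sub_of_local {c : C(I, X) → A} (hc : IsPathCocycle c) (f : X → A)
    (hloc : ∀ x : X, ∃ V : Set X, IsOpen V ∧ x ∈ V ∧
      ∀ γ : C(I, X), (∀ t, γ t ∈ V) → c γ = f (γ 1) - f (γ 0)) (γ : C(I, X)) :
    c γ = f (γ 1) - f (γ 0) := by
  choose V hV hxV hcV using hloc
  obtain ⟨t, ht0, htm, ⟨n, hn⟩, ht⟩ := exists_monotone_Icc_subset_open_cover_unitInterval
    (c := fun x => γ ⁻¹' V x) (fun x => (hV x).preimage γ.continuous)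
    (fun s _ => Set.mem_iUnion.2 ⟨γ s, hxV _⟩)
  -- Extending γ to ℝ turns its pieces into images of segments, to which
  -- `IsPathCocycle.segmentPath_add` applies.
  let q : C(ℝ, X) := ⟨fun s => γ (Set.projIcc 0 1 zero_le_one s), by fun_prop⟩
  have hq (s : I) : q s = γ s := congrArg γ (Set.projIcc_val _ s)
  have hstep (m : ℕ) : c (segmentPath q (t m) (t (m + 1))) = f (γ (t (m + 1))) - f (γ (t m)) := by
    obtain ⟨x, hx⟩ := ht m
    rw [hcV x]
    · simp [segmentPath, hq]
    · intro s
      have hm : (t m : ℝ) ≤ t (m + 1) := htm (Nat.le_succ m)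
      have hs : (t m : ℝ) + (s : ℝ) • ((t (m + 1) : ℝ) - t m) ∈
          Set.Icc (t m : ℝ) (t (m + 1)) := by
        constructor <;> simp only [smul_eq_mul] <;> nlinarith [s.2.1, s.2.2]
      let r : I := ⟨_, (t m).2.1.trans hs.1, hs.2.trans (t (m + 1)).2.2⟩
      have hr : segmentPath q (t m) (t (m + 1)) s = γ r := hq r
      rw [hr]
      exact hx hs
  have hsum (m : ℕ) : c (segmentPath q (t 0) (t m)) = f (γ (t m)) - f (γ (t 0)) := by
    induction m with
    | zero => rw [hc.segmentPath_self, sub_self]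
    | succ m ih => rw [← hc.segmentPath_add q _ (t m), ih, hstep]; abel
  have h := hsum n
  rw [ht0, hn n le_rfl] at h
  rw [← h]
  congr 1
  ext s
  simpa [segmentPath] using (hq s).symm

/-- Let `p : E → X` be a surjection such that the images of the segments joining points of the same
fibre are killed by `c`. If `X` is locally contractible by images of linear contractions, then the
cocycle `c` is a coboundary. -/
theorem IsPathCocycle.exists_eq_sub {c : C(I, X) → A} (hc : IsPathCocycle c) (p : C(E, X))
    (hp : Function.Surjective p) (hcp : ∀ u v, p u = p v → c (segmentPath p u v) = 0)
    (hloc : ∀ x : X, ∃ V : Set X, IsOpen V ∧ x ∈ V ∧ ∃ (e : E) (h : I × V → X), Continuous h ∧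
      ∀ y : V, ∃ u, p u = y ∧ ∀ s : I, h (s, y) = p (e + (s : ℝ) • (u - e))) :
    ∃ f : X → A, ∀ γ, c γ = f (γ 1) - f (γ 0) := by
  choose l hl using hp
  let f (x : X) : A := c (segmentPath p 0 (l x))
  refine ⟨f, hc.eq_sub_of_local f fun x => ?_⟩
  obtain ⟨V, hV, hx, e, h, hh, hu⟩ := hloc x
  refine ⟨V, hV, hx, fun γ hγ => ?_⟩
  -- This square contracts γ to p e; its sides t = 0 and t = 1 are images of segments issuing from
  -- e.
  have hsq := hc.square ⟨fun x => h (x.1, ⟨γ x.2, hγ _⟩), by fun_prop⟩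
  have hend (t : I) : c ⟨fun s => h (s, ⟨γ t, hγ t⟩), by fun_prop⟩ =
      c (segmentPath p e 0) + c (segmentPath p 0 (l (γ t))) := by
    obtain ⟨u, hut, hus⟩ := hu ⟨γ t, hγ t⟩
    -- The contraction uses a lift u of γ t that may differ from the chosen lift; the segment
    -- between them is killed by `hcp`.
    rw [hc.segmentPath_add, ← add_zero (c (segmentPath p e _)),
      ← hcp (l (γ t)) u (by rw [hl, hut]), hc.segmentPath_add]
    congr 1
    ext s
    exact hus s
  have h0 : (⟨fun t => h (0, ⟨γ t, hγ t⟩), by fun_prop⟩ : C(I, X)) =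
      ContinuousMap.const I (p e) := by
    ext t
    obtain ⟨u, hut, hus⟩ := hu ⟨γ t, hγ t⟩
    simpa using hus 0
  have h1 : (⟨fun t => h (1, ⟨γ t, hγ t⟩), by fun_prop⟩ : C(I, X)) = γ := by
    ext t
    obtain ⟨u, hut, hus⟩ := hu ⟨γ t, hγ t⟩
    simpa [hut] using hus 1
  simp only [ContinuousMap.coe_mk, hend, h0, h1, hc.const] at hsq
  rw [eq_sub_iff_add_eq, ← add_right_inj (c (segmentPath p e 0)), ← add_assoc,
    add_right_comm, hsq, zero_add]

end Segments

/-- If `p` is invariant under the central symmetry `u ↦ a - u`, a cocycle kills the image of the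
segment from `u` to `a - u`. -/
theorem IsPathCocycle.segmentPath_eq_zero {E X A : Type} [AddCommGroup E] [Module ℝ E]
    [TopologicalSpace E] [IsTopologicalAddGroup E] [ContinuousSMul ℝ E] [TopologicalSpace X]
    [AddCommGroup A] {c : C(I, X) → A} (hc : IsPathCocycle c) (p : C(E, X)) (a : E)
    (ha : ∀ u, p (a - u) = p u) (u : E) : c (segmentPath p u (a - u)) = 0 := by
  -- The symmetry fixes the midpoint a/2 and exchanges the two halves of the segment.
  have h : segmentPath p ((2⁻¹ : ℝ) • a) (a - u) = segmentPath p ((2⁻¹ : ℝ) • a) u := by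
    ext s
    simp only [segmentPath, ContinuousMap.coe_mk]
    rw [← ha]
    congr 1
    module
  have h1 := hc.segmentPath_add p u ((2⁻¹ : ℝ) • a) (a - u)
  rw [← h1, h, hc.segmentPath_add, hc.segmentPath_self]

/-- Integral vectors. -/
def intVector {ι : Type} (n : ι → ℤ) : ι → ℝ := fun i => n i

theorem IsPathCocycle.segmentPath_eq_zero_of_eq {ι X A : Type} [TopologicalSpace X]
    [AddCommGroup A] {c : C(I, X) → A} (hc : IsPathCocycle c) (p : C(ι → ℝ, X))
    (hp : ∀ u v, p u = p v ↔ ∃ n : ι → ℤ, v = u + intVector n ∨ v = intVector n - u)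
    (u v : ι → ℝ) (huv : p u = p v) : c (segmentPath p u v) = 0 := by
  have hs (n : ι → ℤ) (u : ι → ℝ) : p (intVector n - u) = p u :=
    ((hp _ _).2 ⟨n, Or.inr rfl⟩).symm
  obtain ⟨n, rfl | rfl⟩ := (hp u v).1 huv
  -- The translation by n is the symmetry u ↦ 0 - u followed by v ↦ n - v.
  · rw [← hc.segmentPath_add p u (intVector 0 - u),
      hc.segmentPath_eq_zero p _ (hs 0),
      show u + intVector n = intVector n - (intVector 0 - u) by ext; simp [intVector]; ring,
      hc.segmentPath_eq_zero p _ (hs n), add_zero]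
  · exact hc.segmentPath_eq_zero p _ (hs n) u

/-! ### Local structure of the quotient by integral translations and `- id` -/

theorem exists_pos_forall_int_lt (a : ℝ) : ∃ r > 0, ∀ n : ℤ, |n - a| < r → (n : ℝ) = a := by
  by_cases h : a = round a
  · refine ⟨1, one_pos, fun n hn => ?_⟩
    rw [h] at hn ⊢
    have : |n - round a| < 1 := by exact_mod_cast hn
    rw [Int.abs_lt_one_iff, sub_eq_zero] at this
    rw [this]
  · refine ⟨|a - round a|, abs_pos.2 (sub_ne_zero.2 h), fun n hn => ?_⟩
    rw [abs_sub_comm] at hn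
    exact absurd hn (round_le a n).not_gt

theorem exists_pos_forall_intVector {ι : Type} [Fintype ι] (a : ι → ℝ) :
    ∃ r > 0, ∀ n : ι → ℤ, dist (intVector n) a < r → intVector n = a := by
  choose r hr h using fun i => exists_pos_forall_int_lt (a i)
  obtain ⟨s, hs, hsr⟩ : ∃ s > 0, ∀ i, s ≤ r i := by
    cases isEmpty_or_nonempty ι
    · exact ⟨1, one_pos, fun i => isEmptyElim i⟩
    · obtain ⟨i, hi⟩ := Finite.exists_min r
      exact ⟨r i, hr i, hi⟩
  refine ⟨s, hs, fun n hn => funext fun i => h i _ ?_⟩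
  exact ((dist_le_pi_dist (intVector n) a i).trans_lt hn).trans_le (hsr i)

/-- The quotient of `ℝ^ι` by the group generated by the integral translations and `- id` is locally
contractible by images of linear contractions. -/
theorem exists_local_contraction {ι X : Type} [Fintype ι] [TopologicalSpace X] (p : C(ι → ℝ, X))
    (hopen : IsOpenQuotientMap p)
    (hp : ∀ u v, p u = p v ↔ ∃ n : ι → ℤ, v = u + intVector n ∨ v = intVector n - u) (x : X) :
    ∃ V : Set X, IsOpen V ∧ x ∈ V ∧ ∃ (e : ι → ℝ) (h : I × V → X), Continuous h ∧
      ∀ y : V, ∃ u, p u = y ∧ ∀ s : I, h (s, y) = p (e + (s : ℝ) • (u - e)) := by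
  obtain ⟨e, rfl⟩ := hopen.surjective x
  obtain ⟨r₀, hr₀, h₀⟩ := exists_pos_forall_intVector (0 : ι → ℝ)
  obtain ⟨r₁, hr₁, h₁⟩ := exists_pos_forall_intVector (e + e)
  obtain ⟨r, hr, hrr₀, hrr₁⟩ : ∃ r > 0, r + r ≤ r₀ ∧ r + r ≤ r₁ :=
    ⟨min r₀ r₁ / 2, by positivity, by simp, by simp⟩
  let B := Metric.ball e r
  have hB : IsOpen B := Metric.isOpen_ball
  have hV : IsOpen (p '' B) := hopen.isOpenMap _ hB
  refine ⟨p '' B, hV, ⟨e, Metric.mem_ball_self hr, rfl⟩, e, ?_⟩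
  -- Two points of the ball differing by n have |n| < 2r, so n = 0. If u + v = n, then n is within
  -- 2r of 2e, so n = 2e, and the symmetry about e commutes with the contraction to e.
  have key (u v) (hu : u ∈ B) (hv : v ∈ B) (huv : p u = p v) (s : ℝ) :
      p (e + s • (u - e)) = p (e + s • (v - e)) := by
    rw [Metric.mem_ball] at hu hv
    obtain ⟨n, rfl | rfl⟩ := (hp u v).1 huv
    · have : intVector n = 0 := h₀ n (by
        have := dist_triangle_right (u + intVector n) u e
        rw [dist_self_add_left] at this
        rw [dist_zero_right]
        linarith)
      rw [this, add_zero]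
    · have : intVector n = e + e := h₁ n (by
        have := dist_add_add_le (intVector n - u) u e e
        rw [sub_add_cancel] at this
        linarith)
      refine (hp _ _).2 ⟨n, Or.inr ?_⟩
      rw [this]
      module
  choose l hlB hl using fun y : p '' B => y.2
  refine ⟨fun z => p (e + (z.1 : ℝ) • (l z.2 - e)), ?_, fun y => ⟨l y, hl y, fun s => rfl⟩⟩
  let pB : B → p '' B := fun u => ⟨p u, u, u.2, rfl⟩
  have hpB : IsOpenQuotientMap pB :=
    { surjective := by rintro ⟨_, u, hu, rfl⟩; exact ⟨⟨u, hu⟩, rfl⟩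
      continuous := by fun_prop
      isOpenMap := hV.isOpenEmbedding_subtypeVal.isOpenMap_iff.2
        (hopen.isOpenMap.comp hB.isOpenMap_subtype_val) }
  -- The section l need not be continuous. Pulled back to I × B, the contraction does not depend on
  -- l, by `key`, and is given by a continuous formula.
  rw [(IsOpenQuotientMap.id.prodMap hpB).isQuotientMap.continuous_iff]
  have : Continuous fun z : I × B => p (e + (z.1 : ℝ) • ((z.2 : ι → ℝ) - e)) := by fun_prop
  convert this using 2 with z
  exact key _ _ (hlB _) z.2.2 (hl _) _

/-- The first singular homology of the quotient of `ℝ^ι` by the group generated by the integral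
translations and `- id` vanishes. -/
theorem isZero_homologyOne_of_isOpenQuotientMap {ι : Type} [Fintype ι] {X : TopCat.{0}}
    (p : C(ι → ℝ, X)) (hopen : IsOpenQuotientMap p)
    (hp : ∀ u v, p u = p v ↔ ∃ n : ι → ℤ, v = u + intVector n ∨ v = intVector n - u) :
    CategoryTheory.Limits.IsZero (homologyOne.obj X) :=
  isZero_homology_one _ fun _ _ _ hc => hc.exists_eq_sub p hopen.surjective
    (hc.segmentPath_eq_zero_of_eq p hp) (exists_local_contraction p hopen hp)

end KummerPolarization
end

noncomputable section

open scoped TensorProduct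

namespace KummerPolarization

/-! ## The coordinates of the Jacobians -/

section Coordinates

variable {g : ℕ}

/-- The homomorphism `π_1(handlebody) → ℤ` which counts the occurrences of `b_i`. -/
def letterCount (i : Fin g) : HOne (HandlebodyGroup g) →+ ℤ :=
  MonoidHom.toAdditiveLeft (Abelianization.lift
    (FreeGroup.lift fun j => Multiplicative.ofAdd (if i = j then (1 : ℤ) else 0)))

theorem letterCount_mk (i j : Fin g) :
    letterCount i (HOne.mk (FreeGroup.of j)) = if i = j then 1 else 0 := by
  simp [letterCount, HOne.mk]

/-- The `i`-th coordinate `H_1(handlebody, ℝ) → ℝ`. -/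
def realCoordinate (i : Fin g) : (ℝ ⊗[ℤ] HOne (HandlebodyGroup g)) →+ ℝ :=
  ((TensorProduct.rid ℤ ℝ).toLinearMap ∘ₗ
    LinearMap.lTensor ℝ (letterCount i).toIntLinearMap).toAddMonoidHom

/-- The `i`-th coordinate of the Jacobian of the handlebody. -/
def torusCoordinate (i : Fin g) : HandlebodyJacobian g →+ UnitAddCircle :=
  QuotientAddGroup.map _ _ (realCoordinate i) (by
    rintro _ ⟨c, rfl⟩
    exact ⟨letterCount i c, by simp [realCoordinate]⟩)

theorem torusCoordinate_smulClass (i : Fin g) (c : HOne (HandlebodyGroup g)) (t : UnitAddCircle) :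
    torusCoordinate i (HomologyTorus.smulClass c t) = letterCount i c • t := by
  induction t using QuotientAddGroup.induction_on with
  | H t =>
    change ((realCoordinate i (t ⊗ₜ c) : ℝ) : UnitAddCircle) = _
    simp [realCoordinate]

theorem map_smulClass {G G' : Type} [Group G] [Group G'] (f : G →* G') (c : HOne G)
    (t : UnitAddCircle) :
    HomologyTorus.map f (HomologyTorus.smulClass c t) =
      HomologyTorus.smulClass (HOne.map f c) t := by
  induction t using QuotientAddGroup.induction_on with
  | H t => rfl

/-- Poincaré duality gives b_i the coefficient angle (ρ a_i), and the terms in a_i die in the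
handlebody. -/
theorem jacobianMap_apply (ρ : Jacobian g) :
    jacobianMap g ρ = ∑ i, HomologyTorus.smulClass (HOne.mk (FreeGroup.of i))
      (angle (ρ.eval (genA i))) := by
  have ha (i : Fin g) : HOne.map (killA g) (HOne.mk (genA i)) = 0 := by
    have : killA g (genA i) = 1 := PresentedGroup.toGroup.of (killA_rel g)
    simp [HOne.map, HOne.mk, this]
  have hb (i : Fin g) : HOne.map (killA g) (HOne.mk (genB i)) = HOne.mk (FreeGroup.of i) := by
    have : killA g (genB i) = FreeGroup.of i := PresentedGroup.toGroup.of (killA_rel g)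
    simp [HOne.map, HOne.mk, this]
  have h0 (t : UnitAddCircle) :
      HomologyTorus.smulClass (0 : HOne (HandlebodyGroup g)) t = 0 := by
    induction t using QuotientAddGroup.induction_on with
    | H t =>
      change ((t ⊗ₜ 0 : ℝ ⊗[ℤ] HOne (HandlebodyGroup g)) : HandlebodyJacobian g) = _
      rw [TensorProduct.tmul_zero]
      rfl
  simp [jacobianMap, poincareDuality, map_smulClass, ha, hb, h0]
  rfl

theorem torusCoordinate_jacobianMap (i : Fin g) (ρ : Jacobian g) :
    torusCoordinate i (jacobianMap g ρ) = angle (ρ.eval (genA i)) := by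
  simp [jacobianMap_apply, torusCoordinate_smulClass, letterCount_mk]

theorem angle_injective : Function.Injective angle :=
  fun z w h => by rw [← toCircle_angle z, h, toCircle_angle]

/-- The polarization remembers exactly the coordinates α: the torus coordinates of the handlebody
recover them. -/
theorem jacobianMap_eq_iff (ρ σ : Jacobian g) :
    jacobianMap g ρ = jacobianMap g σ ↔ ∀ i, ρ.eval (genA i) = σ.eval (genA i) := by
  constructor
  · intro h i
    apply angle_injective
    rw [← torusCoordinate_jacobianMap, h, torusCoordinate_jacobianMap]
  · intro h
    simp [jacobianMap_apply, h]

theorem Jacobian.eval_injective : Function.Injective (Jacobian.eval (g := g)) :=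
  fun _ _ h => Additive.toMul.injective (MonoidHom.ext fun γ => congrFun h γ)

theorem Jacobian.ext_generators {ρ σ : Jacobian g}
    (ha : ∀ i, ρ.eval (genA i) = σ.eval (genA i)) (hb : ∀ i, ρ.eval (genB i) = σ.eval (genB i)) :
    ρ = σ :=
  Additive.toMul.injective (PresentedGroup.ext (by rintro (i | i); exacts [ha i, hb i]))

theorem Jacobian.eval_neg (ρ : Jacobian g) (γ : SurfaceGroup g) :
    (-ρ).eval γ = (ρ.eval γ)⁻¹ := rfl

theorem Jacobian.eval_add (ρ σ : Jacobian g) (γ : SurfaceGroup g) :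
    (ρ + σ).eval γ = ρ.eval γ * σ.eval γ := rfl

theorem coverMap_eval_genA (x : Cover g) (i : Fin g) :
    (coverMap x).eval (genA i) = Circle.exp (2 * Real.pi * x.1 i) :=
  PresentedGroup.toGroup.of (cover_rel x)

theorem coverMap_eval_genB (x : Cover g) (i : Fin g) :
    (coverMap x).eval (genB i) = Circle.exp (2 * Real.pi * x.2 i) :=
  PresentedGroup.toGroup.of (cover_rel x)

theorem Jacobian.continuous_eval : Continuous (Jacobian.eval (g := g)) := continuous_induced_dom

/-- The topology tests every element of the surface group; induction on words reduces this to the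
generators. -/
theorem continuous_coverMap : Continuous (coverMap (g := g)) := by
  refine continuous_induced_rng.2 (continuous_pi fun γ => ?_)
  induction γ using PresentedGroup.induction_on with
  | _ w =>
    induction w using FreeGroup.induction_on with
    | C1 => exact continuous_const
    | of l =>
      cases l with
      | a i => exact (show Continuous fun x : Cover g => Circle.exp (2 * Real.pi * x.1 i) by
          fun_prop).congr fun x => (coverMap_eval_genA x i).symm
      | b i => exact (show Continuous fun x : Cover g => Circle.exp (2 * Real.pi * x.2 i) by
          fun_prop).congr fun x => (coverMap_eval_genB x i).symm
    | inv_of l h => exact h.inv.congr fun x => by simp [Jacobian.eval]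
    | mul v w hv hw => exact (hv.mul hw).congr fun x => by simp [Jacobian.eval]

theorem exp_two_pi_mul_eq_iff (s t : ℝ) :
    Circle.exp (2 * Real.pi * s) = Circle.exp (2 * Real.pi * t) ↔ ∃ n : ℤ, t = s + n := by
  rw [eq_comm, Circle.exp_eq_exp]
  have := Real.pi_pos.ne'
  refine exists_congr fun n => ⟨fun h => ?_, fun h => by rw [h]; ring⟩
  apply mul_left_cancel₀ (mul_ne_zero two_ne_zero this)
  linarith

theorem exists_exp_two_pi_mul_eq (z : Circle) :
    ∃ t ∈ Set.Icc (0 : ℝ) 1, Circle.exp (2 * Real.pi * t) = z := by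
  refine ⟨Int.fract (Complex.arg z / (2 * Real.pi)), ⟨Int.fract_nonneg _, (Int.fract_lt_one _).le⟩,
    ?_⟩
  trans Circle.exp (2 * Real.pi * (Complex.arg z / (2 * Real.pi)))
  · exact (exp_two_pi_mul_eq_iff _ _).2 ⟨_, (Int.fract_add_floor _).symm⟩
  · rw [mul_div_cancel₀ _ (by positivity), Circle.exp_arg]

end Coordinates

/-! ## The topology of the Kummer variety -/

section Topology

variable (g : ℕ)

instance : T2Space (Jacobian g) :=
  T2Space.of_injective_continuous Jacobian.eval_injective Jacobian.continuous_eval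

instance : ContinuousNeg (Jacobian g) :=
  ⟨continuous_induced_rng.2 (continuous_pi fun γ =>
    ((continuous_apply γ).comp Jacobian.continuous_eval).inv)⟩

theorem kummer_mk_eq_iff {A : Type} [AddCommGroup A] {x y : A} :
    KummerQuotient.mk x = KummerQuotient.mk y ↔ x = y ∨ x = -y := Quotient.eq

theorem isOpenQuotientMap_kummer :
    IsOpenQuotientMap (KummerQuotient.mk : Jacobian g → Kummer g) where
  surjective := Quotient.mk_surjective
  continuous := continuous_quotient_mk'
  isOpenMap U hU := by
    rw [isOpen_coinduced]
    convert hU.union (hU.preimage continuous_neg)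
    ext x
    constructor
    · rintro ⟨y, hy, hyx⟩
      rcases kummer_mk_eq_iff.1 hyx with rfl | rfl
      · exact Or.inl hy
      · exact Or.inr hy
    · rintro (hx | hx)
      · exact ⟨x, hx, rfl⟩
      · exact ⟨-x, hx, kummer_mk_eq_iff.2 (Or.inr rfl)⟩

/-- The quotient map is open and the graph of the relation is the union of two closed sets, x = y
and x = -y. -/
instance : T2Space (Kummer g) := by
  rw [t2Space_iff_of_isOpenQuotientMap (isOpenQuotientMap_kummer g)]
  simp only [kummer_mk_eq_iff, Set.ofPred_or]
  exact (isClosed_eq continuous_fst continuous_snd).union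
    (isClosed_eq continuous_fst continuous_snd.neg)

/-- A character of order dividing 2 takes values ±1 and is determined by its values on the
generators. -/
theorem finite_singularLocus : (singularLocus g).Finite := by
  refine Set.Finite.image _ ?_
  let F (ρ : Jacobian g) : (Fin g ⊕ Fin g) → ℂ :=
    Sum.elim (fun i => ρ.eval (genA i)) (fun i => ρ.eval (genB i))
  have hF : Function.Injective F := fun ρ σ h => Jacobian.ext_generators
    (fun i => Circle.ext (congrFun h (Sum.inl i))) (fun i => Circle.ext (congrFun h (Sum.inr i)))
  refine Set.Finite.of_finite_image (f := F) ?_ hF.injOn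
  refine (Set.Finite.pi' (t := fun _ => ({1, -1} : Set ℂ)) fun _ => Set.toFinite _).subset ?_
  rintro _ ⟨ρ, hρ, rfl⟩
  have h (γ : SurfaceGroup g) : (ρ.eval γ : ℂ) = 1 ∨ (ρ.eval γ : ℂ) = -1 := by
    rw [← sq_eq_one_iff, sq, ← Circle.coe_mul, ← Jacobian.eval_add, ← two_nsmul, hρ]
    rfl
  rintro (i | i)
  exacts [h _, h _]

end Topology

end KummerPolarization
end

noncomputable section

namespace KummerPolarization

/-! ## The singular fibres -/

/-- A continuous map to a Hausdorff space whose fibres are the orbits of the group generated by the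
integral translations and `- id`, and which is surjective on the unit cube, is an open quotient
map. -/
theorem isOpenQuotientMap_of_cube {ι X : Type} [Fintype ι] [TopologicalSpace X] [T2Space X]
    (p : C(ι → ℝ, X)) (hsurj : ∀ x, ∃ u ∈ Set.Icc (0 : ι → ℝ) 1, p u = x)
    (hp : ∀ u v, p u = p v ↔ ∃ n : ι → ℤ, v = u + intVector n ∨ v = intVector n - u) :
    IsOpenQuotientMap p := by
  -- A continuous surjection from the compact cube to a Hausdorff space is a quotient map.
  have hc : Topology.IsQuotientMap (p ∘ ((↑) : Set.Icc (0 : ι → ℝ) 1 → ι → ℝ)) :=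
    .of_surjective_continuous
      (fun x => let ⟨u, hu, hx⟩ := hsurj x; ⟨⟨u, hu⟩, hx⟩) (by fun_prop)
  have hq : Topology.IsQuotientMap p := .of_comp continuous_subtype_val p.continuous hc
  refine ⟨hq.surjective, hq.continuous, fun U hU => ?_⟩
  rw [← hq.isOpen_preimage]
  have : p ⁻¹' (p '' U) = ⋃ n : ι → ℤ,
      ((fun v => v + intVector n) ⁻¹' U ∪ (fun v => intVector n - v) ⁻¹' U) := by
    ext v
    simp only [Set.mem_iUnion, Set.mem_union, Set.mem_preimage]
    constructor
    · rintro ⟨u, hu, huv⟩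
      obtain ⟨n, rfl | rfl⟩ := (hp v u).1 huv.symm
      · exact ⟨n, Or.inl hu⟩
      · exact ⟨n, Or.inr hu⟩
    · rintro ⟨n, hn | hn⟩
      · exact ⟨_, hn, ((hp _ _).2 ⟨n, Or.inl rfl⟩).symm⟩
      · exact ⟨_, hn, ((hp _ _).2 ⟨n, Or.inr rfl⟩).symm⟩
  rw [this]
  exact isOpen_iUnion fun n => (hU.preimage (by fun_prop)).union (hU.preimage (by fun_prop))

section Fibre

variable {g : ℕ}

/-- Since h = -h, the preimage of the Kummer fibre is a single fibre of the Jacobian, stable under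
`- id`. -/
theorem mk_mem_fibre_iff {h : HandlebodyJacobian g} (h2 : 2 • h = 0) (ρ : Jacobian g) :
    KummerQuotient.mk ρ ∈ fibre (KummerQuotient.mk h) ↔ jacobianMap g ρ = h := by
  change KummerQuotient.mk (jacobianMap g ρ) = KummerQuotient.mk h ↔ _
  have : -h = h := by rw [neg_eq_iff_add_eq_zero, ← two_nsmul, h2]
  rw [kummer_mk_eq_iff, this, or_self]

theorem exists_forall_eq_int {ι : Type} {u v : ι → ℝ} :
    (∀ i, ∃ n : ℤ, v i = u i + n) ↔ ∃ n : ι → ℤ, v = u + intVector n := by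
  rw [Classical.skolem]
  exact exists_congr fun n => (funext_iff (f := v) (g := u + intVector n)).symm

theorem coverMap_eq_iff (α u v : Fin g → ℝ) :
    coverMap (α, u) = coverMap (α, v) ↔ ∃ n : Fin g → ℤ, v = u + intVector n := by
  rw [← exists_forall_eq_int]
  constructor
  · intro h i
    rw [← exp_two_pi_mul_eq_iff]
    simpa only [coverMap_eval_genB] using congrArg (fun ρ => ρ.eval (genB i)) h
  · intro h
    refine Jacobian.ext_generators (fun i => by simp only [coverMap_eval_genA]) fun i => ?_
    simpa only [coverMap_eval_genB, exp_two_pi_mul_eq_iff] using h i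

/-- The hypothesis says that 2α is integral, so negation preserves the slice over α. -/
theorem coverMap_neg (α u : Fin g → ℝ) (hα : ∀ i, ∃ n : ℤ, α i = -α i + n) :
    -coverMap (α, u) = coverMap (α, -u) := by
  refine Jacobian.ext_generators (fun i => ?_) fun i => ?_
  · rw [Jacobian.eval_neg, coverMap_eval_genA, coverMap_eval_genA, ← Circle.exp_neg, ← mul_neg]
    exact (exp_two_pi_mul_eq_iff _ _).2 (hα i)
  · rw [Jacobian.eval_neg, coverMap_eval_genB, coverMap_eval_genB, ← Circle.exp_neg, ← mul_neg]
    rfl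

theorem kummer_mk_coverMap_eq_iff (α u v : Fin g → ℝ) (hα : ∀ i, ∃ n : ℤ, α i = -α i + n) :
    KummerQuotient.mk (coverMap (α, u)) = KummerQuotient.mk (coverMap (α, v)) ↔
      ∃ n : Fin g → ℤ, v = u + intVector n ∨ v = intVector n - u := by
  rw [kummer_mk_eq_iff, coverMap_neg α v hα, coverMap_eq_iff, coverMap_eq_iff, exists_or]
  -- The equation -v = u + n reads v = -n - u, hence the witness -n in both directions.
  refine or_congr Iff.rfl ⟨?_, ?_⟩ <;> rintro ⟨n, hn⟩ <;> refine ⟨-n, ?_⟩ <;> ext i <;>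
    have := congrFun hn i <;> simp [intVector] at this ⊢ <;> linarith

/-- The first homology of a singular fibre vanishes. -/
theorem isZero_homologyOne_fibre {w : HandlebodyKummer g} (hw : IsSingularFibre w)
    (hne : (fibre w).Nonempty) :
    CategoryTheory.Limits.IsZero (homologyOne.obj (TopCat.of (fibre w))) := by
  obtain ⟨h, h2, rfl⟩ := hw
  obtain ⟨y, hy⟩ := hne
  obtain ⟨ρ₀, rfl⟩ := Quotient.exists_rep y
  obtain rfl := (mk_mem_fibre_iff h2 ρ₀).1 hy
  choose α _ hα using fun i => exists_exp_two_pi_mul_eq (ρ₀.eval (genA i))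
  -- The image of ρ₀ is 2-torsion, so ρ₀ and -ρ₀ agree on every a_i.
  have hα2 (i) : ∃ n : ℤ, α i = -α i + n := by
    have := (jacobianMap_eq_iff ρ₀ (-ρ₀)).1 (by
      rw [map_neg, eq_neg_iff_add_eq_zero, ← two_nsmul]; exact h2) i
    rw [← exp_two_pi_mul_eq_iff, mul_neg, Circle.exp_neg, hα]
    exact this.symm
  have hmem (ρ : Jacobian g) : KummerQuotient.mk ρ ∈ fibre (KummerQuotient.mk (jacobianMap g ρ₀)) ↔
      ∀ i, ρ.eval (genA i) = Circle.exp (2 * Real.pi * α i) := by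
    simp only [mk_mem_fibre_iff h2, jacobianMap_eq_iff, hα]
  let p : C(Fin g → ℝ, TopCat.of (fibre (KummerQuotient.mk (jacobianMap g ρ₀)))) :=
    ⟨fun u => ⟨KummerQuotient.mk (coverMap (α, u)), (hmem _).2 (coverMap_eval_genA _)⟩,
      Continuous.subtype_mk ((isOpenQuotientMap_kummer g).continuous.comp
        (continuous_coverMap.comp (by fun_prop))) _⟩
  have hp (u v) : p u = p v ↔ ∃ n : Fin g → ℤ, v = u + intVector n ∨ v = intVector n - u :=
    Subtype.ext_iff.trans (kummer_mk_coverMap_eq_iff α u v hα2)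
  have hT2 : T2Space (TopCat.of (fibre (KummerQuotient.mk (jacobianMap g ρ₀)))) :=
    inferInstanceAs (T2Space (fibre (KummerQuotient.mk (jacobianMap g ρ₀))))
  refine isZero_homologyOne_of_isOpenQuotientMap p (isOpenQuotientMap_of_cube p ?_ hp) hp
  rintro ⟨y, hy⟩
  obtain ⟨ρ, rfl⟩ := Quotient.exists_rep y
  choose u hu hρu using fun i => exists_exp_two_pi_mul_eq (ρ.eval (genB i))
  refine ⟨u, ⟨fun i => (hu i).1, fun i => (hu i).2⟩, Subtype.ext (congrArg KummerQuotient.mk ?_)⟩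
  refine Jacobian.ext_generators (fun i => ?_) fun i => ?_
  · rw [coverMap_eval_genA, (hmem ρ).1 hy]
  · rw [coverMap_eval_genB, hρu]

theorem isZero_homologyOne_of_finite {X : Type} [TopologicalSpace X] [T1Space X] [Finite X] :
    CategoryTheory.Limits.IsZero (homologyOne.obj (TopCat.of X)) := by
  have : TotallyDisconnectedSpace (TopCat.of X) := inferInstanceAs (TotallyDisconnectedSpace X)
  exact AlgebraicTopology.isZero_singularHomologyFunctor_of_totallyDisconnectedSpace _ _ _ _
    one_ne_zero

end Fibre

end KummerPolarization

end

/-- For every level `k` Bohr–Sommerfeld fibre `π⁻¹(w)` of the real polarization of the Kummer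
variety `K_Σ` that is singular, the inclusion of `π⁻¹(w) ∩ Sing K_Σ` in `π⁻¹(w)` induces an
isomorphism on the first integral homology. -/
theorem proposition3p2 (g k : ℕ) (w : KummerPolarization.HandlebodyKummer g)
    (hsing : KummerPolarization.IsSingularFibre w)
    (hBS : KummerPolarization.IsBohrSommerfeld k w) :
    CategoryTheory.IsIso (KummerPolarization.homologyOne.map
      (KummerPolarization.subspaceInclusion
        (Set.inter_subset_left :
          KummerPolarization.fibre w ∩ KummerPolarization.singularLocus g ⊆
            KummerPolarization.fibre w))) := by
  have : Finite ↥(KummerPolarization.fibre w ∩ KummerPolarization.singularLocus g) :=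
    ((KummerPolarization.finite_singularLocus g).subset Set.inter_subset_right).to_subtype
  refine CategoryTheory.Limits.isIso_of_isInitial
    KummerPolarization.isZero_homologyOne_of_finite.isInitial
    (CategoryTheory.Limits.IsZero.isInitial ?_) _
  -- Treating an empty fibre as a finite space avoids proving that the polarization is surjective.
  rcases (KummerPolarization.fibre w).eq_empty_or_nonempty with h | h
  · have : Finite (KummerPolarization.fibre w) := by rw [h]; infer_instance
    exact KummerPolarization.isZero_homologyOne_of_finite
  · exact KummerPolarization.isZero_homologyOne_fibre hsing h
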